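/- Let $f:\mathbb R^d\to\mathbb R$ and $P:\mathbb R^d\to\mathbb R^s$ be continuously differentiable, let $D\subseteq\mathbb R^s$ be closed, and consider the problem $\min_z f(z)$ subject to $P(z)\in D$, with feasible set $\Omega:=\{z\mid P(z)\in D\}$. Let $\bar z\in\Omega$. Notation. For a set $C$ in a Euclidean space and $y\in C$, the tangent cone is $T_C(y):=\{w\mid \exists\, t_k\downarrow 0,\ w_k\to w:\ y+t_kw_k\in C\ \forall k\}$, and the regular normal cone is $\widehat N_C(y):=(T_C(y))^*$, where $K^*:=\{w^*\mid\langle w^*,w\rangle\le 0\ \forall w\in K\}$; for $y\notin C$ both $T_C(y)$ and $\widehat N_C(y)$ are empty. For a cone $C$, $\mathcal L(C)$ is the largest linear subspace $L$ with $C+L\subseteq C$. A set is polyhedral if it is a finite union of sets each of which is the intersection of finitely many closed halfspaces; a set $C$ is locally polyhedral near $y\in C$ if $C\cap W=C'\cap W$ for some neighborhood $W$ of $y$ and some polyhedral set $C'$. The higher order tangent cones to $D$ are defined by $T^0_D(y):=T_D(y)$ and $T^k_D(y;v_1,\ldots,v_k):=T_{T^{k-1}_D(y;v_1,\ldots,v_{k-1})}(v_k)$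 for $k\ge1$. The linearized tangent cones at $\bar z$ are $T^{\rm lin,0}(\bar z):=T^{\rm lin}(\bar z):=\{u\in\mathbb R^d\mid\nabla P(\bar z)u\in T_D(P(\bar z))\}$ and, for $k\ge1$, $T^{{\rm lin},k}(\bar z;u_1,\ldots,u_k):=\{u\in\mathbb R^d\mid\nabla P(\bar z)u\in T^k_D(P(\bar z);\nabla P(\bar z)u_1,\ldots,\nabla P(\bar z)u_k)\}$. Assume that 1. $\bar z$ is B-stationary, i.e. $0\in\nabla f(\bar z)+\widehat N_\Omega(\bar z)$; 2. the generalized Guignard constraint qualification holds at $\bar z$, i.e. $\widehat N_\Omega(\bar z)=\big(T^{\rm lin}(\bar z)\big)^*$; 3. the set-valued mapping $M(u):=\nabla P(\bar z)u-T_D(P(\bar z))$ is metrically subregular at $(0,0)$, i.e. there are a neighborhood $W$ of $0$ and $\kappa>0$ with ${\rm dist}(u,M^{-1}(0))\le\kappa\,{\rm dist}(0,M(u))$ for all $u\in W$. Then there exist a natural number $k\ge0$, directions $u_1,\ldots,u_k\in\mathbb R^d$, a point $w\in T^k_D(P(\bar z);\nabla P(\bar z)u_1,\ldots,\nabla P(\bar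 z)u_k)$ and a multiplier $w^*\in\widehat N_{T^k_D(P(\bar z);\nabla P(\bar z)u_1,\ldots,\nabla P(\bar z)u_k)}(w)$ such that $$\nabla f(\bar z)+\nabla P(\bar z)^*w^*=0,$$ and such that for every $l=1,\ldots,k$ $$u_l\in T^{{\rm lin},l-1}(\bar z;u_1,\ldots,u_{l-1}),\qquad \nabla P(\bar z)u_l\notin\mathcal L\big(T^{l-1}_D(P(\bar z);\nabla P(\bar z)u_1,\ldots,\nabla P(\bar z)u_{l-1})\big),\qquad \langle\nabla f(\bar z),u_l\rangle=0,$$ and $T^{l-1}_D(P(\bar z);\nabla P(\bar z)u_1,\ldots,\nabla P(\bar z)u_{l-1})$ is not locally polyhedral near $\nabla P(\bar z)u_l$. -/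

import Mathlib

open Filter Topology

section Cones

variable {E : Type*} [NormedAddCommGroup E] [InnerProductSpace ℝ E]

/-- The Bouligand (contingent) tangent cone `T_Ω(z)`: all limits `w` of sequences `w_k` such that
`z + t_k w_k ∈ Ω` for some `t_k ↓ 0`. It is empty when `z ∉ Ω`. -/
def bouligandCone (Ω : Set E) (z : E) : Set E :=
  {w | z ∈ Ω ∧ ∃ (t : ℕ → ℝ) (v : ℕ → E), (∀ k, 0 < t k) ∧ Tendsto t atTop (𝓝 0) ∧
    Tendsto v atTop (𝓝 w) ∧ ∀ k, z + t k • v k ∈ Ω}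

/-- The polar cone `C^* = {w | ⟨w, c⟩ ≤ 0 for all c ∈ C}`. -/
def polarCone (C : Set E) : Set E :=
  {w | ∀ c ∈ C, inner ℝ w c ≤ 0}

/-- The regular (Fréchet) normal cone `N̂_Ω(z) = (T_Ω(z))^*`; it is empty when `z ∉ Ω`. -/
def regularNormalCone (Ω : Set E) (z : E) : Set E :=
  {w | z ∈ Ω ∧ w ∈ polarCone (bouligandCone Ω z)}

/-- The generalized lineality space `L(C)`: the largest subspace `L` with `C + L ⊆ C`
(see `isGreatest_linealitySpace`). -/
def linealitySpace (C : Set E) : Submodule ℝ E :=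
  sSup {L : Submodule ℝ E | ∀ c ∈ C, ∀ l ∈ L, c + l ∈ C}

theorem isGreatest_linealitySpace (C : Set E) :
    IsGreatest {L : Submodule ℝ E | ∀ c ∈ C, ∀ l ∈ L, c + l ∈ C} (linealitySpace C) := by
  refine ⟨?_, fun L hL => le_sSup hL⟩
  intro c hc l hl
  unfold linealitySpace at hl
  rw [sSup_eq_iSup] at hl
  induction hl using Submodule.iSup_induction' generalizing c with
  | mem L x hx =>
    by_cases hL : L ∈ {L : Submodule ℝ E | ∀ c ∈ C, ∀ l ∈ L, c + l ∈ C}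
    · rw [iSup_pos hL] at hx
      exact hL c hc x hx
    · rw [iSup_neg hL] at hx
      rw [(Submodule.mem_bot ℝ).1 hx, add_zero]
      exact hc
  | zero => simpa using hc
  | add x y _ _ hx hy =>
    rw [← add_assoc]
    exact hy _ (hx _ hc)

/-- A convex polyhedral set: an intersection of finitely many closed halfspaces. -/
def IsConvexPolyhedral (C : Set E) : Prop :=
  ∃ (p : ℕ) (a : Fin p → E) (α : Fin p → ℝ), C = {z | ∀ i, inner ℝ (a i) z ≤ α i}

/-- A polyhedral set: a union of finitely many convex polyhedral sets. -/
def IsPolyhedral (C : Set E) : Prop :=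
  ∃ (q : ℕ) (A : Fin q → Set E), (∀ i, IsConvexPolyhedral (A i)) ∧ C = ⋃ i, A i

/-- `Ω` is locally polyhedral near `z`: it coincides with a polyhedral set on a neighborhood
of `z`. -/
def IsLocallyPolyhedralNear (Ω : Set E) (z : E) : Prop :=
  ∃ W ∈ 𝓝 z, ∃ C : Set E, IsPolyhedral C ∧ Ω ∩ W = C ∩ W

/-- The `k`-th order tangent cone `T^k_D(y; v_1, …, v_k)`:
`T^0_D(y) = T_D(y)` and `T^k_D(y; v_1, …, v_k)` is the tangent cone to
`T^{k-1}_D(y; v_1, …, v_{k-1})` at `v_k`. -/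
def iteratedTangentCone (D : Set E) (y : E) : (k : ℕ) → (Fin k → E) → Set E
  | 0, _ => bouligandCone D y
  | k + 1, v => bouligandCone (iteratedTangentCone D y k (Fin.init v)) (v (Fin.last k))

end Cones

section Stationarity

variable {E F : Type*} [NormedAddCommGroup E] [InnerProductSpace ℝ E]
  [NormedAddCommGroup F] [InnerProductSpace ℝ F]

/-- Metric subregularity of the set-valued mapping `M` at the point `(z, w)` of its graph.
Distances are extended-real valued, so that the distance to the empty set is `∞`. -/
def MetricallySubregularAt (M : E → Set F) (z : E) (w : F) : Prop :=
  w ∈ M z ∧ ∃ W ∈ 𝓝 z, ∃ κ : ℝ, 0 < κ ∧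
    ∀ x ∈ W, Metric.infEDist x {x' | w ∈ M x'} ≤ ENNReal.ofReal κ * Metric.infEDist w (M x)

/-- The linearized tangent cone `{u | ∇P(z) u ∈ T_D(P(z))}`. -/
def linearizedTangentCone (P : E → F) (D : Set F) (z : E) : Set E :=
  {u | fderiv ℝ P z u ∈ bouligandCone D (P z)}

/-- The `k`-th order linearized tangent cone
`{u | ∇P(z) u ∈ T^k_D(P(z); ∇P(z) u_1, …, ∇P(z) u_k)}`. -/
def iteratedLinearizedTangentCone (P : E → F) (D : Set F) (z : E) (k : ℕ) (u : Fin k → E) :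
    Set E :=
  {x | fderiv ℝ P z x ∈ iteratedTangentCone D (P z) k (fun i => fderiv ℝ P z (u i))}

/-- B-stationarity of `z` for `min f` subject to `P(z) ∈ D`: the point `z` is feasible and
`0 ∈ ∇f(z) + N̂_Ω(z)`, where `Ω = P⁻¹(D)`. -/
def IsBStationary [CompleteSpace E] (f : E → ℝ) (P : E → F) (D : Set F) (z : E) : Prop :=
  P z ∈ D ∧ ∃ n ∈ regularNormalCone (P ⁻¹' D) z, gradient f z + n = 0

/-- The generalized Guignard constraint qualification at `z`: `N̂_Ω(z)` is the polar of the
linearized tangent cone, where `Ω = P⁻¹(D)`. -/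
def SatisfiesGGCQ (P : E → F) (D : Set F) (z : E) : Prop :=
  P z ∈ D ∧ regularNormalCone (P ⁻¹' D) z = polarCone (linearizedTangentCone P D z)

end Stationarity

/-! ### Tangent cones under affine changes and near locally polyhedral points -/

section TangentCones

/-! Write `A` for the derivative of `P`, `g` for the gradient of `f`, `K` for the tangent cone to
`D`. B-stationarity and the Guignard condition give `⟨g, u⟩ ≥ 0` whenever `A u ∈ K`; subregularity
strengthens this to the exact penalty inequality `⟨g, u⟩ + L ‖A u - v‖ ≥ 0` for all `u` and all `v ∈
K` (`penalty_of_metricallySubregularAt`).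

Minimize `⟨g, u⟩ + ‖A u - v‖² / 2` over `v ∈ K`, with `u` orthogonal to the preimage of the
lineality space. If a minimizer exists, its residual is a multiplier; otherwise normalizing an
unbounded sequence of sublevel points yields a critical direction outside the lineality space
(`exists_multiplier_or_direction`). The penalty inequality passes to the tangent cone in that
direction (`penalty_bouligandCone`), whose lineality space is strictly larger, so the process stops
by finite dimension.

Directions near which the cone is locally polyhedral are removed: there the cone is a translate of
its tangent cone, so the next point or direction can be scaled down and moved into the original cone
(`HasMultiplierChain.of_bouligandCone`). -/

variable {E : Type*} [NormedAddCommGroup E] [InnerProductSpace ℝ E]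

/-- A nonempty closed cone. -/
structure IsClosedCone (K : Set E) : Prop where
  isClosed : IsClosed K
  zero_mem : (0 : E) ∈ K
  smul_mem : ∀ c : ℝ, 0 < c → ∀ x ∈ K, c • x ∈ K

theorem IsClosedCone.smul_mem_iff {K : Set E} (hK : IsClosedCone K) {c : ℝ} (hc : 0 < c) {x : E} :
    c • x ∈ K ↔ x ∈ K := by
  refine ⟨fun h => ?_, hK.smul_mem c hc x⟩
  have := hK.smul_mem c⁻¹ (inv_pos.2 hc) _ h
  rwa [inv_smul_smul₀ hc.ne'] at this

theorem mem_bouligandCone_iff {C : Set E} {z w : E} :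
    w ∈ bouligandCone C z ↔ z ∈ C ∧ ∀ ε > 0, ∃ t : ℝ, 0 < t ∧ t < ε ∧ ∃ v : E,
      dist v w < ε ∧ z + t • v ∈ C := by
  constructor
  · rintro ⟨hz, t, v, ht, ht0, hv, h⟩
    refine ⟨hz, fun ε hε => ?_⟩
    obtain ⟨k, hk1, hk2⟩ := ((ht0.eventually (gt_mem_nhds hε)).and
      (hv.eventually (Metric.ball_mem_nhds w hε))).exists
    exact ⟨t k, ht k, hk1, v k, hk2, h k⟩
  · rintro ⟨hz, h⟩
    choose t ht htε v hv hC using fun k : ℕ => h (1 / ((k : ℝ) + 1)) (by positivity)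
    refine ⟨hz, t, v, ht, ?_, ?_, hC⟩
    · exact squeeze_zero (fun k => (ht k).le) (fun k => (htε k).le)
        tendsto_one_div_add_atTop_nhds_zero_nat
    · rw [tendsto_iff_dist_tendsto_zero]
      exact squeeze_zero (fun k => dist_nonneg) (fun k => (hv k).le)
        tendsto_one_div_add_atTop_nhds_zero_nat

theorem isClosedCone_bouligandCone {C : Set E} {z : E} (hz : z ∈ C) :
    IsClosedCone (bouligandCone C z) where
  isClosed := by
    rw [← closure_subset_iff_isClosed]
    intro w hw
    rw [mem_bouligandCone_iff]
    refine ⟨hz, fun ε hε => ?_⟩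
    obtain ⟨w', hw', hd⟩ := Metric.mem_closure_iff.1 hw (ε / 2) (half_pos hε)
    obtain ⟨t, ht, htε, v, hv, h⟩ := (mem_bouligandCone_iff.1 hw').2 (ε / 2) (half_pos hε)
    refine ⟨t, ht, by linarith, v, ?_, h⟩
    have := dist_triangle v w' w
    rw [dist_comm w' w] at this
    linarith
  zero_mem := ⟨hz, fun k => 1 / ((k : ℝ) + 1), fun _ => 0, fun k => by positivity,
    tendsto_one_div_add_atTop_nhds_zero_nat, tendsto_const_nhds, fun k => by simpa using hz⟩
  smul_mem := by
    rintro c hc x ⟨-, t, v, ht, ht0, hv, h⟩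
    refine ⟨hz, fun k => c⁻¹ * t k, fun k => c • v k, fun k => mul_pos (inv_pos.2 hc) (ht k), ?_,
      hv.const_smul c, fun k => ?_⟩
    · simpa using ht0.const_mul c⁻¹
    · have : (c⁻¹ * t k) • c • v k = t k • v k := by
        rw [smul_smul]; congr 1; field_simp
      rw [this]; exact h k

/-- Tangent cones depend only on the germ of the set. The dilation by `c` is absorbed into the step
length, so the tangent directions themselves do not change. -/
theorem bouligandCone_subset_of_eventually {C C' : Set E} {z b : E} {c : ℝ} (hc : 0 < c)
    (h : ∀ᶠ x in 𝓝 z, c • x + b ∈ C ↔ x ∈ C') :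
    bouligandCone C (c • z + b) ⊆ bouligandCone C' z := by
  intro w hw
  rw [mem_bouligandCone_iff] at hw ⊢
  refine ⟨h.self_of_nhds.1 hw.1, fun ε hε => ?_⟩
  obtain ⟨δ, hδ, hball⟩ := Metric.eventually_nhds_iff.1 h
  have hlim : Tendsto (fun p : ℝ × E => z + (c⁻¹ * p.1) • p.2) (𝓝 (0, w)) (𝓝 z) := by
    have : Continuous (fun p : ℝ × E => z + (c⁻¹ * p.1) • p.2) := by fun_prop
    simpa using this.tendsto (0, w)
  obtain ⟨η, hη, hη'⟩ := Metric.eventually_nhds_iff.1 (hlim.eventually (Metric.ball_mem_nhds z hδ))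
  have hm : 0 < min η (min ε (c * ε)) := by positivity
  obtain ⟨t, ht, htε, v, hv, hC⟩ := hw.2 _ hm
  simp only [lt_min_iff] at htε hv
  refine ⟨c⁻¹ * t, mul_pos (inv_pos.2 hc) ht, ?_, v, hv.2.1, ?_⟩
  · rw [inv_mul_lt_iff₀ hc]; exact htε.2.2
  · have hd : dist ((t, v) : ℝ × E) (0, w) < η := by
      rw [Prod.dist_eq]
      refine max_lt ?_ hv.1
      simpa [abs_of_pos ht] using htε.1
    have := hη' hd
    refine (hball this).1 ?_
    convert hC using 1
    rw [smul_add, smul_smul, mul_inv_cancel_left₀ hc.ne']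
    abel

theorem bouligandCone_eq_of_eventually {C C' : Set E} {z b : E} {c : ℝ} (hc : 0 < c)
    (h : ∀ᶠ x in 𝓝 z, c • x + b ∈ C ↔ x ∈ C') :
    bouligandCone C (c • z + b) = bouligandCone C' z := by
  refine (bouligandCone_subset_of_eventually hc h).antisymm ?_
  have hz : c⁻¹ • (c • z + b) + -(c⁻¹ • b) = z := by
    rw [smul_add, inv_smul_smul₀ hc.ne']; abel
  have key : ∀ᶠ x in 𝓝 (c • z + b), c⁻¹ • x + -(c⁻¹ • b) ∈ C' ↔ x ∈ C := by
    have hlim : Tendsto (fun x => c⁻¹ • x + -(c⁻¹ • b)) (𝓝 (c • z + b)) (𝓝 z) := by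
      have : Continuous (fun x => c⁻¹ • x + -(c⁻¹ • b)) := by fun_prop
      simpa only [hz] using this.tendsto (c • z + b)
    filter_upwards [hlim.eventually h] with x hx
    rw [← hx, smul_add, smul_inv_smul₀ hc.ne', smul_neg, smul_inv_smul₀ hc.ne']
    simp
  have := bouligandCone_subset_of_eventually (inv_pos.2 hc) key
  rwa [hz] at this

theorem IsPolyhedral.preimage_smul_add {C : Set E} (hC : IsPolyhedral C) (c : ℝ) (b : E) :
    IsPolyhedral {x | c • x + b ∈ C} := by
  obtain ⟨q, A, hA, rfl⟩ := hC
  refine ⟨q, fun i => {x | c • x + b ∈ A i}, fun i => ?_, by ext; simp⟩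
  obtain ⟨p, a, α, h⟩ := hA i
  refine ⟨p, fun j => c • a j, fun j => α j - inner ℝ (a j) b, ?_⟩
  ext x
  simp only [h, Set.mem_ofPred_eq, inner_add_right, inner_smul_right, real_inner_smul_left,
    le_sub_iff_add_le]

theorem IsLocallyPolyhedralNear.of_eventually {C C' : Set E} {z b : E} {c : ℝ}
    (h : ∀ᶠ x in 𝓝 z, c • x + b ∈ C ↔ x ∈ C') (hC : IsLocallyPolyhedralNear C (c • z + b)) :
    IsLocallyPolyhedralNear C' z := by
  obtain ⟨W, hW, Q, hQ, hCQ⟩ := hC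
  have hlim : Tendsto (fun x => c • x + b) (𝓝 z) (𝓝 (c • z + b)) :=
    Continuous.tendsto (by fun_prop) z
  refine ⟨_, h.and (hlim hW), _, hQ.preimage_smul_add c b, ?_⟩
  ext x
  refine and_congr_left fun hx => ?_
  have := Set.ext_iff.1 hCQ (c • x + b)
  have hxW : c • x + b ∈ W := hx.2
  simp only [Set.mem_inter_iff, hxW, and_true] at this
  rw [← hx.1, this]; rfl

/-- Near a point, a locally polyhedral set coincides with its translated tangent cone. -/
theorem IsLocallyPolyhedralNear.eventually_mem_iff {C : Set E} {z : E} (hz : z ∈ C)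
    (hC : IsLocallyPolyhedralNear C z) :
    ∀ᶠ x in 𝓝 (0 : E), z + x ∈ C ↔ x ∈ bouligandCone C z := by
  obtain ⟨W, hW, Q, ⟨q, A, hA, rfl⟩, hCQ⟩ := hC
  have hCW : ∀ x ∈ W, (x ∈ C ↔ ∃ i, x ∈ A i) := fun x hx => by
    have := Set.ext_iff.1 hCQ x
    simpa [hx] using this
  choose p a α hA using hA
  have hadd : Tendsto (fun x => z + x) (𝓝 (0 : E)) (𝓝 z) := by
    have : Continuous (fun x => z + x) := by fun_prop
    simpa using this.tendsto 0
  -- inequalities that are strict at `z` keep their sign near `z`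
  have hsign : ∀ᶠ y in 𝓝 z, ∀ i j, (inner ℝ (a i j) z < α i j → inner ℝ (a i j) y < α i j) ∧
      (α i j < inner ℝ (a i j) z → α i j < inner ℝ (a i j) y) := by
    refine eventually_all.2 fun i => eventually_all.2 fun j => ?_
    have hc : Tendsto (fun y => inner ℝ (a i j) y) (𝓝 z) (𝓝 (inner ℝ (a i j) z)) :=
      Continuous.tendsto (by fun_prop) z
    refine Filter.Eventually.and ?_ ?_
    · by_cases h : inner ℝ (a i j) z < α i j
      · filter_upwards [hc.eventually (gt_mem_nhds h)] with y hy _ using hy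
      · exact Eventually.of_forall fun _ h' => absurd h' h
    · by_cases h : α i j < inner ℝ (a i j) z
      · filter_upwards [hc.eventually (lt_mem_nhds h)] with y hy _ using hy
      · exact Eventually.of_forall fun _ h' => absurd h' h
  have hgood := hsign.and hW
  obtain ⟨δ, hδ, hball⟩ := Metric.eventually_nhds_iff.1 hgood
  -- Pieces that miss `z` also miss the whole ball: an inequality violated at `z` stays violated
  -- nearby.
  have hmem : ∀ y, dist y z < δ → ∀ i, y ∈ A i → z ∈ A i := by
    intro y hy i hi
    rw [hA] at hi ⊢
    intro j
    by_contra hlt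
    exact absurd (hi j) (not_le.2 (((hball hy).1 i j).2 (not_le.1 hlt)))
  filter_upwards [Metric.ball_mem_nhds (0 : E) hδ] with x hx
  have hx' : ‖x‖ < δ := by simpa using hx
  have hxz : dist (z + x) z < δ := by simpa using hx'
  constructor
  · intro h
    obtain ⟨i, hi⟩ := (hCW _ (hball hxz).2).1 h
    have hzi := hmem _ hxz i hi
    refine ⟨hz, fun k => 1 / ((k : ℝ) + 1), fun _ => x, fun k => by positivity,
      tendsto_one_div_add_atTop_nhds_zero_nat, tendsto_const_nhds, fun k => ?_⟩
    have ht0 : 0 < 1 / ((k : ℝ) + 1) := by positivity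
    have ht1 : 1 / ((k : ℝ) + 1) ≤ 1 := by
      rw [div_le_one (by positivity)]; linarith [(Nat.cast_nonneg k : (0 : ℝ) ≤ k)]
    beta_reduce
    generalize 1 / ((k : ℝ) + 1) = t at ht0 ht1 ⊢
    have hd : dist (z + t • x) z < δ := by
      rw [dist_self_add_left, norm_smul, Real.norm_eq_abs, abs_of_pos ht0]
      exact (mul_le_of_le_one_left (norm_nonneg x) ht1).trans_lt hx'
    refine (hCW _ (hball hd).2).2 ⟨i, ?_⟩
    -- The piece is convex and contains both `z` and `z + x`, hence the segment between them.
    rw [hA] at hi hzi ⊢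
    intro j
    have h1 := hi j
    have h2 := hzi j
    rw [inner_add_right] at h1
    rw [inner_add_right, inner_smul_right]
    nlinarith
  · rintro ⟨-, t, v, ht, ht0, hv, h⟩
    have hlim : Tendsto (fun k => z + t k • v k) atTop (𝓝 z) := by
      simpa using tendsto_const_nhds.add (ht0.smul hv)
    have hev := hlim.eventually (Metric.ball_mem_nhds z hδ)
    -- Pigeonhole: one of the finitely many pieces contains infinitely many terms of the sequence.
    have hfreq : ∃ i, ∃ᶠ k in atTop, z + t k • v k ∈ A i := by
      by_contra hno
      simp only [not_exists, not_frequently] at hno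
      obtain ⟨k, hk, hk'⟩ := (hev.and (eventually_all.2 hno)).exists
      obtain ⟨i, hi⟩ := (hCW _ (hball hk).2).1 (h k)
      exact hk' i hi
    obtain ⟨i, hi⟩ := hfreq
    obtain ⟨k, hk, hk'⟩ := (hi.and_eventually hev).exists
    have hzi := hmem _ hk' i hk
    refine (hCW _ (hball hxz).2).2 ⟨i, ?_⟩
    rw [hA] at hzi ⊢
    intro j
    -- Inactive constraints hold throughout the ball; active ones pass to the limit after division
    -- by `t k`.
    rcases (hzi j).lt_or_eq with hlt | heq
    · exact (((hball hxz).1 i j).1 hlt).le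
    · have hle : inner ℝ (a i j) x ≤ 0 := by
        have hc : Tendsto (fun k => inner ℝ (a i j) (v k)) atTop (𝓝 (inner ℝ (a i j) x)) :=
          tendsto_const_nhds.inner hv
        refine le_of_tendsto_of_frequently hc (hi.mono fun k hk => ?_)
        rw [hA] at hk
        have := hk j
        rw [inner_add_right, inner_smul_right, heq] at this
        by_contra hpos
        nlinarith [mul_pos (ht k) (not_le.1 hpos)]
      rw [inner_add_right]
      linarith

end TangentCones

/-! ### Growth of the lineality space -/

section Lineality

variable {F : Type*} [NormedAddCommGroup F] [InnerProductSpace ℝ F]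

theorem add_mem_of_mem_linealitySpace {K : Set F} {x l : F} (hx : x ∈ K)
    (hl : l ∈ linealitySpace K) : x + l ∈ K :=
  (isGreatest_linealitySpace K).1 x hx l hl

theorem IsClosedCone.linealitySpace_subset {K : Set F} (hK : IsClosedCone K) :
    (linealitySpace K : Set F) ⊆ K := fun l hl => by
  simpa using add_mem_of_mem_linealitySpace hK.zero_mem hl

theorem linealitySpace_le_linealitySpace_bouligandCone (K : Set F) (v : F) :
    linealitySpace K ≤ linealitySpace (bouligandCone K v) := by
  refine (isGreatest_linealitySpace _).2 ?_
  rintro w ⟨hv, t, x, ht, ht0, hx, h⟩ l hl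
  refine ⟨hv, t, fun k => x k + l, ht, ht0, hx.add_const l, fun k => ?_⟩
  rw [smul_add, ← add_assoc]
  exact add_mem_of_mem_linealitySpace (h k) (Submodule.smul_mem _ _ hl)

/-- Moving along `v` is a rescaling, which a cone permits: if `v + t x ∈ K`, then multiplying by `(1
- t α)⁻¹` gives `v + τ (x + α v) ∈ K` with `τ = t / (1 - t α)`. -/
theorem IsClosedCone.mem_linealitySpace_bouligandCone {K : Set F} (hK : IsClosedCone K) (v : F) :
    v ∈ linealitySpace (bouligandCone K v) := by
  have hle : Submodule.span ℝ {v} ≤ linealitySpace (bouligandCone K v) := by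
    refine (isGreatest_linealitySpace _).2 ?_
    intro w hw l hl
    obtain ⟨α, rfl⟩ := Submodule.mem_span_singleton.1 hl
    rw [mem_bouligandCone_iff] at hw ⊢
    refine ⟨hw.1, fun ε hε => ?_⟩
    have hpos : ∀ᶠ t : ℝ in 𝓝 0, 0 < 1 - t * α ∧ t / (1 - t * α) < ε := by
      refine Eventually.and ?_ ?_
      · have : Tendsto (fun t : ℝ => 1 - t * α) (𝓝 0) (𝓝 1) := by
          have : Continuous (fun t : ℝ => 1 - t * α) := by fun_prop
          simpa using this.tendsto 0
        exact this.eventually (lt_mem_nhds one_pos)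
      · have : Tendsto (fun t : ℝ => t / (1 - t * α)) (𝓝 0) (𝓝 0) := by
          have : ContinuousAt (fun t : ℝ => t / (1 - t * α)) 0 := by
            refine ContinuousAt.div (by fun_prop) (by fun_prop) (by simp)
          simpa using this.tendsto
        exact this.eventually (gt_mem_nhds hε)
    obtain ⟨δ, hδ, hδ'⟩ := Metric.eventually_nhds_iff.1 hpos
    obtain ⟨t, ht, htδ, x, hx, hxK⟩ := hw.2 (min δ ε) (by positivity)
    simp only [lt_min_iff] at htδ hx
    obtain ⟨h1, h2⟩ := hδ' (y := t) (by simpa [abs_of_pos ht] using htδ.1)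
    refine ⟨t / (1 - t * α), div_pos ht h1, h2, x + α • v, by simpa using hx.2, ?_⟩
    have := hK.smul_mem _ (inv_pos.2 h1) _ hxK
    convert this using 1
    rw [smul_add, smul_add, ← add_assoc, smul_smul, smul_smul]
    have e2 : (1 - t * α)⁻¹ = 1 + t / (1 - t * α) * α := by field_simp; ring
    have e3 : (1 - t * α)⁻¹ * t = t / (1 - t * α) := by ring
    rw [e3, e2, add_smul, one_smul]
    abel
  exact hle (Submodule.mem_span_singleton_self v)

end Lineality

/-! ### Exact penalty and chains of critical directions -/

section Chains

variable {E F : Type*} [NormedAddCommGroup E] [InnerProductSpace ℝ E]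
  [NormedAddCommGroup F] [InnerProductSpace ℝ F] {A : E →L[ℝ] F} {g : E} {K : Set F} {L : ℝ}

/-- The exact penalty inequality is inherited by tangent cones in critical directions. -/
theorem penalty_bouligandCone (hpen : ∀ u : E, ∀ v ∈ K, 0 ≤ inner ℝ g u + L * ‖A u - v‖)
    {u₀ : E} (hg : inner ℝ g u₀ = 0) :
    ∀ u : E, ∀ v ∈ bouligandCone K (A u₀), 0 ≤ inner ℝ g u + L * ‖A u - v‖ := by
  rintro u v ⟨-, t, x, ht, -, hx, h⟩
  have hlim : Tendsto (fun k => inner ℝ g u + L * ‖A u - x k‖) atTop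
      (𝓝 (inner ℝ g u + L * ‖A u - v‖)) :=
    tendsto_const_nhds.add ((tendsto_const_nhds.sub hx).norm.const_mul L)
  refine ge_of_tendsto' hlim fun k => ?_
  -- Since `⟨g, u₀⟩ = 0` and the base point `A u₀` cancels, this inequality is `t k` times the
  -- desired one.
  have := hpen (u₀ + t k • u) _ (h k)
  rw [inner_add_right, hg, inner_smul_right, map_add, map_smul, add_sub_add_left_eq_sub,
    ← smul_sub, norm_smul, Real.norm_eq_abs, abs_of_pos (ht k)] at this
  have h2 : 0 ≤ t k * (inner ℝ g u + L * ‖A u - x k‖) := by linarith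
  exact nonneg_of_mul_nonneg_right h2 (ht k)

/-- Metric subregularity turns the first-order condition on the linearized cone into an exact
penalty inequality. -/
theorem penalty_of_metricallySubregularAt (hK : IsClosedCone K)
    (hg : ∀ u : E, A u ∈ K → 0 ≤ inner ℝ g u)
    (hM : MetricallySubregularAt (fun u => {y | ∃ t ∈ K, y = A u - t}) 0 0) :
    ∃ L : ℝ, ∀ u : E, ∀ v ∈ K, 0 ≤ inner ℝ g u + L * ‖A u - v‖ := by
  obtain ⟨-, W, hW, κ, hκ, hsub⟩ := hM
  -- Moving `u` to a nearby solution of `A x' ∈ K` changes `⟨g, u⟩` by at most `‖g‖` times the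
  -- distance, which subregularity bounds by `κ ‖A u - v‖`. Homogeneity allows `u` to be scaled into
  -- `W` first.
  refine ⟨‖g‖ * κ, fun u v hv => ?_⟩
  have hlim : Tendsto (fun t : ℝ => t • u) (𝓝[>] 0) (𝓝 0) := by
    have : Continuous (fun t : ℝ => t • u) := by fun_prop
    have := this.tendsto 0
    rw [zero_smul] at this
    exact this.mono_left nhdsWithin_le_nhds
  obtain ⟨t, htW, ht⟩ := ((hlim.eventually hW).and self_mem_nhdsWithin).exists
  have ht : 0 < t := ht
  have hle : Metric.infEDist (t • u) {x' | A x' ∈ K} ≤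
      ENNReal.ofReal (κ * (t * ‖A u - v‖)) := by
    have h1 := hsub _ htW
    have hset : {x' : E | (0 : F) ∈ {y | ∃ t ∈ K, y = A x' - t}} = {x' | A x' ∈ K} := by
      ext x'
      constructor
      · rintro ⟨s, hs, h0⟩
        rw [eq_comm, sub_eq_zero] at h0
        change A x' ∈ K
        rwa [h0]
      · intro h
        exact ⟨A x', h, (sub_self _).symm⟩
    rw [hset] at h1
    refine h1.trans ?_
    rw [ENNReal.ofReal_mul hκ.le]
    gcongr
    refine (Metric.infEDist_le_edist_of_mem
      (show A (t • u) - t • v ∈ {y | ∃ s ∈ K, y = A (t • u) - s} from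
        ⟨t • v, hK.smul_mem t ht v hv, rfl⟩)).trans ?_
    rw [edist_dist, dist_zero_left, map_smul, ← smul_sub, norm_smul, Real.norm_eq_abs,
      abs_of_pos ht]
  have hmain : 0 ≤ t * (inner ℝ g u + ‖g‖ * κ * ‖A u - v‖) := by
    refine le_of_forall_pos_le_add fun ε hε => ?_
    set η := ε / (‖g‖ + 1) with hη
    have hηpos : 0 < η := by positivity
    have hlt : Metric.infEDist (t • u) {x' | A x' ∈ K} <
        ENNReal.ofReal (κ * (t * ‖A u - v‖) + η) :=
      hle.trans_lt ((ENNReal.ofReal_lt_ofReal_iff (by positivity)).2 (by linarith))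
    obtain ⟨x', hx', hd⟩ := Metric.infEDist_lt_iff.1 hlt
    rw [edist_dist, ENNReal.ofReal_lt_ofReal_iff (by positivity), dist_eq_norm] at hd
    have h1 := hg x' hx'
    have h2 : -(‖g‖ * ‖t • u - x'‖) ≤ inner ℝ g (t • u - x') :=
      (abs_le.1 (abs_real_inner_le_norm g (t • u - x'))).1
    rw [inner_sub_right, inner_smul_right] at h2
    have h3 : ‖g‖ * ‖t • u - x'‖ ≤ ‖g‖ * (κ * (t * ‖A u - v‖) + η) :=
      mul_le_mul_of_nonneg_left hd.le (norm_nonneg g)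
    have h4 : ‖g‖ * η ≤ ε := by
      rw [hη, mul_div_assoc', div_le_iff₀ (by positivity)]
      nlinarith
    nlinarith
  exact nonneg_of_mul_nonneg_right hmain ht

/-- The condition imposed on the direction with index `l` of a family of directions. -/
def IsAdmissibleAt (A : E →L[ℝ] F) (g : E) (D : Set F) (y : F) {k : ℕ} (u : Fin k → E)
    (l : Fin k) : Prop :=
  A (u l) ∈ iteratedTangentCone D y l (fun i => A (Fin.take l l.isLt.le u i)) ∧
  A (u l) ∉ linealitySpace (iteratedTangentCone D y l
    (fun i => A (Fin.take l l.isLt.le u i))) ∧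
  inner ℝ g (u l) = 0 ∧
  ¬ IsLocallyPolyhedralNear (iteratedTangentCone D y l
    (fun i => A (Fin.take l l.isLt.le u i))) (A (u l))

variable [FiniteDimensional ℝ E] [FiniteDimensional ℝ F]

/-- A multiplier for `g + A* w* = 0` can be reached from the cone `K` by passing finitely often to
the tangent cone in a critical direction, outside the lineality space, near which the current cone
is not locally polyhedral. -/
inductive HasMultiplierChain (A : E →L[ℝ] F) (g : E) : Set F → Prop
  | multiplier {K : Set F} {w wstar : F} (hw : w ∈ K) (hn : wstar ∈ regularNormalCone K w)
      (h0 : g + ContinuousLinearMap.adjoint A wstar = 0) : HasMultiplierChain A g K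
  | direction {K : Set F} {u : E} (hu : A u ∈ K) (hL : A u ∉ linealitySpace K)
      (hg : inner ℝ g u = 0) (hp : ¬ IsLocallyPolyhedralNear K (A u))
      (h : HasMultiplierChain A g (bouligandCone K (A u))) : HasMultiplierChain A g K

/-- A chain for the tangent cone at a critical direction near which the cone is locally polyhedral
yields a chain for the cone itself. -/
theorem HasMultiplierChain.of_bouligandCone (hK : IsClosedCone K) {u : E} (hu : A u ∈ K)
    (hg : inner ℝ g u = 0) (hp : IsLocallyPolyhedralNear K (A u))
    (h : HasMultiplierChain A g (bouligandCone K (A u))) : HasMultiplierChain A g K := by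
  have hcone := isClosedCone_bouligandCone hu
  -- At a small fixed scale `c`, the map `x ↦ c x + A u` carries the tangent cone near `w` onto `K`
  -- near its image. Tangent cones there agree, so only the first link of the chain has to be moved.
  have key : ∀ w : F, ∃ c : ℝ, 0 < c ∧
      ∀ᶠ x in 𝓝 w, c • x + A u ∈ K ↔ x ∈ bouligandCone K (A u) := by
    intro w
    have hloc := hp.eventually_mem_iff hu
    have hlim : Tendsto (fun q : ℝ × F => q.1 • q.2) (𝓝 0 ×ˢ 𝓝 w) (𝓝 0) := by
      have : Continuous (fun q : ℝ × F => q.1 • q.2) := by fun_prop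
      have := this.tendsto (0, w)
      rwa [zero_smul, nhds_prod_eq] at this
    have h2 := (hlim.eventually hloc).curry
    obtain ⟨δ, hδ, hδ'⟩ := Metric.eventually_nhds_iff.1 h2
    have hpos : 0 < δ / 2 := half_pos hδ
    refine ⟨δ / 2, hpos, ?_⟩
    have := hδ' (y := δ / 2) (by rw [Real.dist_eq, sub_zero, abs_of_pos hpos]; linarith)
    filter_upwards [this] with x hx
    rw [add_comm, hx, hcone.smul_mem_iff hpos]
  cases h with
  | @multiplier _ w wstar hw hn h0 =>
    obtain ⟨c, hc, hev⟩ := key w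
    have hw' := hev.self_of_nhds.2 hw
    refine .multiplier hw' (wstar := wstar) ⟨hw', ?_⟩ h0
    rw [bouligandCone_eq_of_eventually hc hev]
    exact hn.2
  | @direction _ u' hu' hL hg' hp' h' =>
    obtain ⟨c, hc, hev⟩ := key (A u')
    have hA : A (c • u' + u) = c • A u' + A u := by simp
    refine .direction (u := c • u' + u) ?_ ?_ ?_ ?_ ?_
    · rw [hA]; exact hev.self_of_nhds.2 hu'
    · rw [hA]
      intro hmem
      have h1 := linealitySpace_le_linealitySpace_bouligandCone K (A u) hmem
      have h2 := (Submodule.add_mem_iff_left _ (hK.mem_linealitySpace_bouligandCone (A u))).1 h1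
      exact hL ((Submodule.smul_mem_iff _ hc.ne').1 h2)
    · rw [inner_add_right, inner_smul_right, hg, hg']; simp
    · rw [hA]; exact fun hl => hp' (hl.of_eventually hev)
    · rw [hA, bouligandCone_eq_of_eventually hc hev]; exact h'

/-- A minimizer of the quadratic penalty function provides a multiplier. -/
theorem exists_multiplier_of_isMin {u₀ : E} {v₀ : F} (hv₀ : v₀ ∈ K)
    (hmin : ∀ u : E, ∀ v ∈ K, inner ℝ g u₀ + ‖A u₀ - v₀‖ ^ 2 / 2 ≤
      inner ℝ g u + ‖A u - v‖ ^ 2 / 2) :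
    A u₀ - v₀ ∈ regularNormalCone K v₀ ∧
      g + ContinuousLinearMap.adjoint A (A u₀ - v₀) = 0 := by
  set y := A u₀ - v₀ with hy
  constructor
  · refine ⟨hv₀, ?_⟩
    rintro v ⟨-, t, x, ht, ht0, hx, h⟩
    have hlim : Tendsto (fun k => t k * ‖x k‖ ^ 2 / 2 - inner ℝ y (x k)) atTop
        (𝓝 (0 * ‖v‖ ^ 2 / 2 - inner ℝ y v)) :=
      ((ht0.mul (hx.norm.pow 2)).div_const 2).sub (tendsto_const_nhds.inner hx)
    have h0 : 0 ≤ 0 * ‖v‖ ^ 2 / 2 - inner ℝ y v := by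
      refine ge_of_tendsto' hlim fun k => ?_
      -- Varying only `v` gives normality; varying only `u`, along `-e` below, gives the gradient
      -- equation.
      have := hmin u₀ _ (h k)
      rw [← sub_sub, ← hy, norm_sub_sq_real y, inner_smul_right, norm_smul, mul_pow,
        Real.norm_eq_abs, sq_abs] at this
      have h2 : 0 ≤ t k * (t k * ‖x k‖ ^ 2 / 2 - inner ℝ y (x k)) := by nlinarith
      exact nonneg_of_mul_nonneg_right h2 (ht k)
    linarith
  · set e := g + ContinuousLinearMap.adjoint A y with he
    have hlim : Tendsto (fun t : ℝ => t * ‖A e‖ ^ 2 / 2 - ‖e‖ ^ 2) (𝓝[>] 0)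
        (𝓝 (0 * ‖A e‖ ^ 2 / 2 - ‖e‖ ^ 2)) := by
      have : Continuous (fun t : ℝ => t * ‖A e‖ ^ 2 / 2 - ‖e‖ ^ 2) := by fun_prop
      exact (this.tendsto 0).mono_left nhdsWithin_le_nhds
    have h0 : 0 ≤ 0 * ‖A e‖ ^ 2 / 2 - ‖e‖ ^ 2 := by
      refine ge_of_tendsto hlim ?_
      filter_upwards [self_mem_nhdsWithin] with t ht
      have ht : 0 < t := ht
      have := hmin (u₀ - t • e) _ hv₀
      have e1 : A (u₀ - t • e) - v₀ = y - t • A e := by rw [map_sub, map_smul, hy]; abel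
      have e2 : ‖e‖ ^ 2 = inner ℝ g e + inner ℝ y (A e) := by
        rw [← real_inner_self_eq_norm_sq]
        nth_rewrite 1 [he]
        rw [inner_add_left, ContinuousLinearMap.adjoint_inner_left]
      rw [e1, norm_sub_sq_real y, inner_smul_right, norm_smul, mul_pow, Real.norm_eq_abs, sq_abs,
        inner_sub_right, inner_smul_right] at this
      have h2 : 0 ≤ t * (t * ‖A e‖ ^ 2 / 2 - ‖e‖ ^ 2) := by rw [e2]; nlinarith
      exact nonneg_of_mul_nonneg_right h2 ht
    have : ‖e‖ ^ 2 = 0 := le_antisymm (by linarith) (sq_nonneg _)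
    exact norm_eq_zero.1 (pow_eq_zero_iff two_ne_zero |>.1 this)

/-- Either a multiplier exists, or there is a critical direction outside the lineality space. -/
theorem exists_multiplier_or_direction (hK : IsClosedCone K)
    (hpen : ∀ u : E, ∀ v ∈ K, 0 ≤ inner ℝ g u + L * ‖A u - v‖) :
    (∃ w ∈ K, ∃ wstar ∈ regularNormalCone K w,
      g + ContinuousLinearMap.adjoint A wstar = 0) ∨
    ∃ u : E, A u ∈ K ∧ A u ∉ linealitySpace K ∧ inner ℝ g u = 0 := by
  set S : Submodule ℝ E := (linealitySpace K).comap A.toLinearMap with hS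
  have hSg : ∀ l ∈ S, inner ℝ g l = 0 := by
    intro l hl
    have hl' : A l ∈ linealitySpace K := hl
    have h1 := hpen l (A l) (hK.linealitySpace_subset hl')
    have h2 := hpen (-l) (A (-l)) (hK.linealitySpace_subset
      (by rw [map_neg]; exact Submodule.neg_mem _ hl'))
    simp only [sub_self, norm_zero, mul_zero, add_zero, inner_neg_right] at h1 h2
    linarith
  set φ : E × F → ℝ := fun q => inner ℝ g q.1 + ‖A q.1 - q.2‖ ^ 2 / 2 with hφ
  have hφc : Continuous φ := by fun_prop
  set Λ : Set (E × F) := {q | q.1 ∈ Sᗮ ∧ q.2 ∈ K ∧ φ q ≤ 0} with hΛ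
  have hΛc : IsClosed Λ := by
    refine ((Submodule.isClosed_orthogonal S).preimage continuous_fst).inter
      ((hK.isClosed.preimage continuous_snd).inter (isClosed_le hφc continuous_const))
  -- With residual norm `r`, `r² / 2 ≤ -⟨g, u⟩ ≤ L r`.
  have hres : ∀ q ∈ Λ, ‖A q.1 - q.2‖ ≤ 2 * |L| := by
    rintro ⟨u, v⟩ ⟨-, hv, hle⟩
    have h1 := hpen u v hv
    simp only [hφ] at hle ⊢
    by_contra hlt
    have hLa := le_abs_self L
    have hn := norm_nonneg (A u - v)
    nlinarith [abs_nonneg L, mul_le_mul_of_nonneg_right hLa hn]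
  by_cases hb : Bornology.IsBounded (Prod.fst '' Λ)
  · left
    have hbΛ : Bornology.IsBounded Λ := by
      obtain ⟨R, hR⟩ := hb.exists_norm_le
      refine isBounded_iff_forall_norm_le.2 ⟨max R (‖A‖ * R + 2 * |L|), fun q hq => ?_⟩
      have h1 : ‖q.1‖ ≤ R := hR _ ⟨q, hq, rfl⟩
      have h2 := hres q hq
      have h3 : ‖q.2‖ ≤ ‖A q.1‖ + ‖A q.1 - q.2‖ := by
        have := norm_sub_le (A q.1) (A q.1 - q.2)
        rwa [sub_sub_cancel] at this
      have h4 : ‖A q.1‖ ≤ ‖A‖ * R :=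
        (A.le_opNorm _).trans (mul_le_mul_of_nonneg_left h1 (norm_nonneg _))
      exact max_le_max h1 (by linarith)
    have h0 : (0 : E × F) ∈ Λ := ⟨Submodule.zero_mem _, hK.zero_mem, by simp [hφ]⟩
    obtain ⟨⟨u₀, v₀⟩, hq₀, hmin⟩ := (Metric.isCompact_of_isClosed_isBounded hΛc hbΛ).exists_isMinOn
      ⟨0, h0⟩ hφc.continuousOn
    refine ⟨v₀, hq₀.2.1, A u₀ - v₀, exists_multiplier_of_isMin hq₀.2.1 fun u v hv => ?_⟩
    -- Shifting `(u, v)` by `(l, A l)` with `l ∈ S` preserves both `K` and the objective, so a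
    -- minimizer over `Sᗮ` is global.
    obtain ⟨l, hl, m, hm, rfl⟩ := S.exists_add_mem_mem_orthogonal u
    have hl' : A l ∈ linealitySpace K := hl
    have hv' : v - A l ∈ K := by
      rw [sub_eq_add_neg]
      exact add_mem_of_mem_linealitySpace hv (Submodule.neg_mem _ hl')
    have heq : inner ℝ g (l + m) + ‖A (l + m) - v‖ ^ 2 / 2 = φ (m, v - A l) := by
      simp only [hφ]
      rw [inner_add_right, hSg l hl, zero_add, map_add]
      congr 4; abel
    rw [heq]
    by_cases hle : φ (m, v - A l) ≤ 0
    · exact hmin (a := (m, v - A l)) ⟨hm, hv', hle⟩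
    · exact hq₀.2.2.trans (not_le.1 hle).le
  · right
    have hex : ∀ n : ℕ, ∃ q ∈ Λ, (n : ℝ) + 1 < ‖q.1‖ := by
      intro n
      by_contra hno
      push Not at hno
      refine hb (isBounded_iff_forall_norm_le.2 ⟨n + 1, ?_⟩)
      rintro _ ⟨q, hq, rfl⟩
      exact hno q hq
    choose q hq hqn using hex
    have hpos : ∀ n, 0 < ‖(q n).1‖ := fun n => lt_trans (by positivity) (hqn n)
    set r : ℕ → ℝ := fun n => ‖(q n).1‖⁻¹ with hr
    have hrpos : ∀ n, 0 < r n := fun n => inv_pos.2 (hpos n)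
    have hr0 : Tendsto r atTop (𝓝 0) := by
      refine squeeze_zero (fun n => (hrpos n).le) (fun n => ?_)
        tendsto_one_div_add_atTop_nhds_zero_nat
      rw [one_div]
      exact inv_anti₀ (by positivity) (hqn n).le
    obtain ⟨e, he, σ, hσ, hlim⟩ := (isCompact_sphere (0 : E) 1).tendsto_subseq
      (x := fun n => r n • (q n).1) (fun n => by
        simp [norm_smul, hr, (hpos n).ne'])
    have hrσ : Tendsto (r ∘ σ) atTop (𝓝 0) := hr0.comp hσ.tendsto_atTop
    have hbdd : ∀ n, |inner ℝ g (q n).1| ≤ |L| * (2 * |L|) := by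
      intro n
      have h1 := hpen (q n).1 (q n).2 (hq n).2.1
      have h2 : φ (q n) ≤ 0 := (hq n).2.2
      have h3 := hres _ (hq n)
      have h5 : L * ‖A (q n).1 - (q n).2‖ ≤ |L| * (2 * |L|) :=
        (mul_le_mul_of_nonneg_right (le_abs_self L) (norm_nonneg _)).trans
          (mul_le_mul_of_nonneg_left h3 (abs_nonneg L))
      have h6 : 0 ≤ |L| * (2 * |L|) := by positivity
      simp only [hφ] at h2
      rw [abs_le]
      constructor
      · linarith
      · nlinarith [sq_nonneg ‖A (q n).1 - (q n).2‖]
    have heS : e ∈ Sᗮ := (Submodule.isClosed_orthogonal S).mem_of_tendsto hlim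
      (Eventually.of_forall fun n => Submodule.smul_mem _ _ (hq _).1)
    have hge : inner ℝ g e = 0 := by
      have h1 : Tendsto (fun n => inner ℝ g (r (σ n) • (q (σ n)).1)) atTop (𝓝 (inner ℝ g e)) :=
        tendsto_const_nhds.inner hlim
      have h2 : Tendsto (fun n => inner ℝ g (r (σ n) • (q (σ n)).1)) atTop (𝓝 0) := by
        refine squeeze_zero_norm (a := fun n => r (σ n) * (|L| * (2 * |L|))) (fun n => ?_) ?_
        · rw [inner_smul_right, norm_mul, Real.norm_eq_abs, Real.norm_eq_abs,
            abs_of_pos (hrpos _)]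
          exact mul_le_mul_of_nonneg_left (hbdd _) (hrpos _).le
        · simpa using hrσ.mul_const (|L| * (2 * |L|))
      exact tendsto_nhds_unique h1 h2
    have hAe : A e ∈ K := by
      -- Residuals are bounded, so after normalization they vanish and the scaled points of `K`
      -- converge to `A e`.
      have h1 : Tendsto (fun n => A (r (σ n) • (q (σ n)).1)) atTop (𝓝 (A e)) :=
        (A.continuous.tendsto e).comp hlim
      have h2 : Tendsto (fun n => r (σ n) • (A (q (σ n)).1 - (q (σ n)).2)) atTop (𝓝 0) := by
        refine squeeze_zero_norm (a := fun n => r (σ n) * (2 * |L|)) (fun n => ?_) ?_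
        · rw [norm_smul, Real.norm_eq_abs, abs_of_pos (hrpos _)]
          exact mul_le_mul_of_nonneg_left (hres _ (hq _)) (hrpos _).le
        · simpa using hrσ.mul_const (2 * |L|)
      have h3 := h1.sub h2
      rw [sub_zero] at h3
      refine hK.isClosed.mem_of_tendsto h3 (Eventually.of_forall fun n => ?_)
      have : A (r (σ n) • (q (σ n)).1) - r (σ n) • (A (q (σ n)).1 - (q (σ n)).2)
          = r (σ n) • (q (σ n)).2 := by
        rw [map_smul, smul_sub, sub_sub_cancel]
      rw [this]
      exact hK.smul_mem _ (hrpos _) _ (hq _).2.1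
    refine ⟨e, hAe, fun hmem => ?_, hge⟩
    have heS' : e ∈ S := hmem
    have : e = 0 := by
      have := (Submodule.mem_orthogonal S e).1 heS e heS'
      exact inner_self_eq_zero.1 this
    simp [this] at he

/-- Induction on the codimension of the lineality space: passing to the tangent cone at `A u` adds
`A u` to it. Polyhedral steps are absorbed on the way back. -/
theorem hasMultiplierChain_of_penalty (hK : IsClosedCone K)
    (hpen : ∀ u : E, ∀ v ∈ K, 0 ≤ inner ℝ g u + L * ‖A u - v‖) : HasMultiplierChain A g K := by
  induction hn : Module.finrank ℝ F - Module.finrank ℝ (linealitySpace K) using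
    Nat.strong_induction_on generalizing K with
  | _ n ih =>
    rcases exists_multiplier_or_direction hK hpen with ⟨w, hw, wstar, hws, h0⟩ | ⟨u, hu, huL, hgu⟩
    · exact .multiplier hw hws h0
    · have hlt : linealitySpace K < linealitySpace (bouligandCone K (A u)) :=
        (linealitySpace_le_linealitySpace_bouligandCone K (A u)).lt_of_not_ge fun hge =>
          huL (hge (hK.mem_linealitySpace_bouligandCone (A u)))
      have h1 := Submodule.finrank_lt_finrank_of_lt hlt
      have h2 := Submodule.finrank_le (linealitySpace (bouligandCone K (A u)))
      have hchain := ih _ (by omega) (isClosedCone_bouligandCone hu)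
        (penalty_bouligandCone hpen hgu) rfl
      by_cases hp : IsLocallyPolyhedralNear K (A u)
      · exact .of_bouligandCone hK hu hgu hp hchain
      · exact .direction hu huL hgu hp hchain

/-- Unrolls a chain into an indexed family; `u` accumulates the directions already used to reach
`K`. Appending at the end leaves the earlier prefixes, hence their admissibility, untouched. -/
theorem HasMultiplierChain.exists_directions {D : Set F} {y : F} (h : HasMultiplierChain A g K)
    {k : ℕ} (u : Fin k → E) (hK : K = iteratedTangentCone D y k (fun i => A (u i)))
    (hu : ∀ l, IsAdmissibleAt A g D y u l) :
    ∃ (k : ℕ) (u : Fin k → E) (w wstar : F),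
      w ∈ iteratedTangentCone D y k (fun i => A (u i)) ∧
      wstar ∈ regularNormalCone (iteratedTangentCone D y k (fun i => A (u i))) w ∧
      g + ContinuousLinearMap.adjoint A wstar = 0 ∧ ∀ l, IsAdmissibleAt A g D y u l := by
  induction h generalizing k with
  | multiplier hw hn h0 =>
    subst hK
    exact ⟨k, u, _, _, hw, hn, h0, hu⟩
  | @direction K x hx hL hg hp _ ih =>
    subst hK
    refine ih (Fin.snoc u x : Fin (k + 1) → E) ?_ fun l => ?_
    · simp only [iteratedTangentCone, Fin.snoc_last]
      congr 2
      funext i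
      simp [Fin.init]
    · refine Fin.lastCases ?_ (fun l => ?_) l
      · have htake : Fin.take k (Nat.le_succ k) (Fin.snoc u x : Fin (k + 1) → E) = u := by
          funext i
          exact Fin.snoc_castSucc (α := fun _ => E) x u i
        have h : IsAdmissibleAt A g D y (Fin.snoc u x : Fin (k + 1) → E) (Fin.last k) := by
          unfold IsAdmissibleAt
          simp only [Fin.snoc_last]
          -- The index `Fin.last k` is replaced by its value `k`, so that the dependent length
          -- allows rewriting with `htake`.
          change A x ∈ iteratedTangentCone D y k (fun i => A (Fin.take k (Nat.le_succ k)
            (Fin.snoc u x : Fin (k + 1) → E) i)) ∧ A x ∉ linealitySpace (iteratedTangentCone D y k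
            (fun i => A (Fin.take k (Nat.le_succ k) (Fin.snoc u x : Fin (k + 1) → E) i))) ∧
            inner ℝ g x = 0 ∧ ¬ IsLocallyPolyhedralNear (iteratedTangentCone D y k
            (fun i => A (Fin.take k (Nat.le_succ k) (Fin.snoc u x : Fin (k + 1) → E) i))) (A x)
          rw [htake]
          exact ⟨hx, hL, hg, hp⟩
        exact h
      · have htake : Fin.take (l : ℕ) (l.castSucc).isLt.le (Fin.snoc u x : Fin (k + 1) → E) =
            Fin.take (l : ℕ) l.isLt.le u := by
          funext i
          exact Fin.snoc_castSucc (α := fun _ => E) x u ⟨i, i.isLt.trans l.isLt⟩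
        have h := hu l
        unfold IsAdmissibleAt at h ⊢
        rw [← htake] at h
        simp only [Fin.snoc_castSucc]
        exact h

end Chains


theorem mainTheorem2 (d s : ℕ)
    (f : EuclideanSpace ℝ (Fin d) → ℝ)
    (P : EuclideanSpace ℝ (Fin d) → EuclideanSpace ℝ (Fin s))
    (D : Set (EuclideanSpace ℝ (Fin s)))
    (hf : ContDiff ℝ 1 f) (hP : ContDiff ℝ 1 P) (hD : IsClosed D)
    (zb : EuclideanSpace ℝ (Fin d))
    (hB : IsBStationary f P D zb)
    (hG : SatisfiesGGCQ P D zb)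
    (hM : MetricallySubregularAt
      (fun u => {y | ∃ t ∈ bouligandCone D (P zb), y = fderiv ℝ P zb u - t}) 0 0) :
    ∃ (k : ℕ) (u : Fin k → EuclideanSpace ℝ (Fin d)) (w wstar : EuclideanSpace ℝ (Fin s)),
      w ∈ iteratedTangentCone D (P zb) k (fun i => fderiv ℝ P zb (u i)) ∧
      wstar ∈ regularNormalCone
        (iteratedTangentCone D (P zb) k (fun i => fderiv ℝ P zb (u i))) w ∧
      gradient f zb + ContinuousLinearMap.adjoint (fderiv ℝ P zb) wstar = 0 ∧
      -- the index `l : Fin k` stands for the direction with number `l + 1`, and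
      -- `Fin.take l _ u` is the family of the directions before it
      ∀ l : Fin k,
        u l ∈ iteratedLinearizedTangentCone P D zb l (Fin.take l l.isLt.le u) ∧
        fderiv ℝ P zb (u l) ∉ linealitySpace (iteratedTangentCone D (P zb) l
          (fun i => fderiv ℝ P zb (Fin.take l l.isLt.le u i))) ∧
        inner ℝ (gradient f zb) (u l) = 0 ∧
        ¬ IsLocallyPolyhedralNear (iteratedTangentCone D (P zb) l
          (fun i => fderiv ℝ P zb (Fin.take l l.isLt.le u i))) (fderiv ℝ P zb (u l)) := by
  have hK := isClosedCone_bouligandCone hB.1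
  have hg : ∀ u, fderiv ℝ P zb u ∈ bouligandCone D (P zb) → 0 ≤ inner ℝ (gradient f zb) u := by
    intro u hu
    obtain ⟨-, n, hn, h0⟩ := hB
    rw [hG.2] at hn
    have := hn u hu
    rw [eq_neg_of_add_eq_zero_left h0, inner_neg_left]
    linarith
  obtain ⟨L, hL⟩ := penalty_of_metricallySubregularAt hK hg hM
  exact (hasMultiplierChain_of_penalty hK hL).exists_directions (D := D) (y := P zb)
    (k := 0) Fin.elim0 rfl (fun l => l.elim0)
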